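/- Let $X$ be a proper metric space with a conical geodesic bicombing $\sigma$, that is, a map $\sigma : X\times X\times[0,1]\to X$ such that, for all $x,y\in X$, the map $t\mapsto\sigma(x,y,t)$ is a constant speed geodesic from $x$ to $y$, and $$d(\sigma(x,y,t),\sigma(x',y',t))\le(1-t)\,d(x,x')+t\,d(y,y')\qquad\text{for all }x,x',y,y'\in X,\ t\in[0,1].$$ A $\sigma$-ray is a geodesic ray $c:[0,\infty)\to X$ (i.e. $d(c(s),c(t))=|s-t|$ for all $s,t\ge 0$) such that $\sigma(c(0),c(t),s)=c(st)$ for all $t\ge0$ and $s\in[0,1]$. Assume that $\sigma$ is geodesically complete: for all $x\ne y$ in $X$ there is a $\sigma$-ray $c$ with $c(0)=x$ and $c(d(x,y))=y$. Let $\partial X$ be the horoboundary of $X$, that is, the set of points of the closure of the image of $X\to\mathbb{R}^X/\mathbb{R}$, $x\mapsto d(x,\cdot)+\mathbb{R}$, that do not lie in this image (here $\mathbb{R}^X$ carries the product topology and $\mathbb{R}$ is the subgroup of constant functions). A point $\xi\in\partial X$ is a Busemann point if there is a geodesic ray $c$ such that $\lim_{t\to\infty}\big(d(x,c(t))-d(y,c(t))\big)=\xi(x)-\xi(y)$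 for all $x,y\in X$; it is then said to correspond to $c$. Let $x_0\in X$ and $N\in\mathbb{N}$ be such that at most $N$ Busemann points correspond to $\sigma$-rays $c$ from $c(0)=x_0$. Then the combinatorial dimension of $X$, i.e. the topological (Lebesgue covering) dimension of its injective hull $EX$, is at most $N$. Here $EX$ is the set of pointwise minimal functions among the $f:X\to\mathbb{R}$ such that $f(x)+f(y)\ge d(x,y)$ for all $x,y\in X$, with the metric $d(f,g)=\sup_{x\in X}|f(x)-g(x)|$. -/

import Mathlib

open Set Filter Topology

namespace CombDim

/-! ### Geodesic bicombings -/

/-- `σ x y : [0,1] → X` is, for all `x y`, a constant speed geodesic from `x` to `y`.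
The parameter is a real number, and only its values in `[0,1]` matter. -/
structure IsGeodesicBicombing {X : Type*} [MetricSpace X] (σ : X → X → ℝ → X) : Prop where
  map_zero : ∀ x y, σ x y 0 = x
  map_one : ∀ x y, σ x y 1 = y
  dist_eq : ∀ x y, ∀ s ∈ Icc (0 : ℝ) 1, ∀ t ∈ Icc (0 : ℝ) 1,
    dist (σ x y s) (σ x y t) = |s - t| * dist x y

/-- The conical inequality. -/
def IsConical {X : Type*} [MetricSpace X] (σ : X → X → ℝ → X) : Prop :=
  ∀ x x' y y' : X, ∀ t ∈ Icc (0 : ℝ) 1,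
    dist (σ x y t) (σ x' y' t) ≤ (1 - t) * dist x x' + t * dist y y'

/-- A (unit speed) geodesic ray `[0,∞) → X`; only the values of `c` on `[0,∞)` matter. -/
def IsGeodesicRay {X : Type*} [MetricSpace X] (c : ℝ → X) : Prop :=
  ∀ s t : ℝ, 0 ≤ s → 0 ≤ t → dist (c s) (c t) = |s - t|

/-- A `σ`-ray: a geodesic ray `c` such that, for every `t ≥ 0`, the initial segment `c|[0,t]` is
the geodesic from `c 0` to `c t` selected by `σ`. -/
structure IsCombingRay {X : Type*} [MetricSpace X] (σ : X → X → ℝ → X) (c : ℝ → X) : Prop where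
  isGeodesicRay : IsGeodesicRay c
  combing_eq : ∀ t : ℝ, 0 ≤ t → ∀ s ∈ Icc (0 : ℝ) 1, σ (c 0) (c t) s = c (s * t)

/-- `σ` is geodesically complete: every nondegenerate `σ`-geodesic, from `x` to `y`, is an initial
segment of a `σ`-ray. (That the ray prolongs `t ↦ σ x y t` is part of being a `σ`-ray from `x`
that passes through `y`.) -/
def IsGeodesicallyComplete {X : Type*} [MetricSpace X] (σ : X → X → ℝ → X) : Prop :=
  ∀ x y : X, x ≠ y → ∃ c : ℝ → X, IsCombingRay σ c ∧ c 0 = x ∧ c (dist x y) = y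

/-! ### The horoboundary and Busemann points -/

/-- The subgroup of constant functions in `ℝ^X`. -/
def constFun (X : Type*) : AddSubgroup (X → ℝ) := (Pi.constAddMonoidHom X ℝ).range

/-- The space `ℝ^X / ℝ`, with the quotient of the product topology. -/
abbrev FunModConst (X : Type*) : Type _ := (X → ℝ) ⧸ constFun X

/-- The well-defined difference `ξ(x) - ξ(y)`, for `ξ ∈ ℝ^X / ℝ`. -/
def FunModConst.diff {X : Type*} (ξ : FunModConst X) (x y : X) : ℝ :=
  QuotientAddGroup.lift (constFun X)
    (Pi.evalAddMonoidHom (fun _ : X => ℝ) x - Pi.evalAddMonoidHom (fun _ : X => ℝ) y)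
    (by rintro f ⟨a, rfl⟩; simp) ξ

theorem FunModConst.diff_mk {X : Type*} (f : X → ℝ) (x y : X) :
    FunModConst.diff (QuotientAddGroup.mk f : FunModConst X) x y = f x - f y := rfl

/-- The embedding `x ↦ d(x, ·) + ℝ` of `X` in `ℝ^X / ℝ`. -/
def horoEmbedding (X : Type*) [MetricSpace X] (x : X) : FunModConst X :=
  QuotientAddGroup.mk (fun y => dist x y)

/-- The horoboundary of `X`: the points in the closure of the image of `X` in `ℝ^X / ℝ` that do
not lie in this image. -/
def horoboundary (X : Type*) [MetricSpace X] : Set (FunModConst X) :=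
  closure (range (horoEmbedding X)) \ range (horoEmbedding X)

/-- `ξ` is the limit of the distance functions along `c`:
`d(x, c(t)) - d(y, c(t)) → ξ(x) - ξ(y)` as `t → ∞`, for all `x` and `y`. -/
def IsLimitOfRay {X : Type*} [MetricSpace X] (ξ : FunModConst X) (c : ℝ → X) : Prop :=
  ∀ x y : X, Tendsto (fun t : ℝ => dist x (c t) - dist y (c t)) atTop (𝓝 (ξ.diff x y))

/-- `ξ` is a Busemann point: a point of the horoboundary that is the limit of a geodesic ray. -/
def IsBusemannPoint {X : Type*} [MetricSpace X] (ξ : FunModConst X) : Prop :=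
  ξ ∈ horoboundary X ∧ ∃ c : ℝ → X, IsGeodesicRay c ∧ IsLimitOfRay ξ c

/-- The Busemann points that correspond to `σ`-rays from `x₀`. -/
def combingBusemannPoints {X : Type*} [MetricSpace X] (σ : X → X → ℝ → X) (x₀ : X) :
    Set (FunModConst X) :=
  {ξ | IsBusemannPoint ξ ∧ ∃ c : ℝ → X, IsCombingRay σ c ∧ c 0 = x₀ ∧ IsLimitOfRay ξ c}

/-! ### The injective hull -/

/-- `f(x) + f(y) ≥ d(x, y)` for all `x` and `y`. -/
def DominatesDist {X : Type*} [MetricSpace X] (f : X → ℝ) : Prop :=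
  ∀ x y, dist x y ≤ f x + f y

/-- The injective hull `EX` of `X` (Isbell): the set of extremal functions on `X`, i.e. the
pointwise minimal functions `f` such that `f(x) + f(y) ≥ d(x, y)` for all `x` and `y`. Below it
gets the supremum metric. -/
def InjectiveHull (X : Type*) [MetricSpace X] : Type _ :=
  {f : X → ℝ // Minimal DominatesDist f}

namespace InjectiveHull

variable {X : Type*} [MetricSpace X]

theorem le_dist_add (f : InjectiveHull X) (x y : X) : f.1 x ≤ dist x y + f.1 y := by
  have hf := f.2.1
  have h : DominatesDist (fun z => min (f.1 z) (dist z y + f.1 y)) := by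
    intro z w
    have h0 := hf y y
    have h1 := hf z w
    have h2 := hf z y
    have h3 := hf w y
    have h4 := dist_triangle_right z w y
    simp only [dist_self] at h0
    rcases min_choice (f.1 z) (dist z y + f.1 y) with h5 | h5 <;>
      rcases min_choice (f.1 w) (dist w y + f.1 y) with h6 | h6 <;>
      simp only [h5, h6] <;> linarith [@dist_nonneg _ _ z y, @dist_nonneg _ _ w y]
  exact (f.2.2 h (fun z => min_le_left _ _) x).trans (min_le_right _ _)

theorem bddAbove_abs_sub (f g : InjectiveHull X) :
    BddAbove (range fun x => |f.1 x - g.1 x|) := by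
  rcases isEmpty_or_nonempty X with hX | ⟨⟨y⟩⟩
  · simp [range_eq_empty]
  · refine ⟨f.1 y + g.1 y, ?_⟩
    rintro _ ⟨x, rfl⟩
    have h1 := f.le_dist_add x y
    have h2 := g.le_dist_add x y
    have h3 := f.2.1 x y
    have h4 := g.2.1 x y
    exact abs_le.2 ⟨by linarith, by linarith⟩

/-- The supremum metric `d(f, g) = sup |f - g|`. -/
noncomputable instance : MetricSpace (InjectiveHull X) where
  dist f g := ⨆ x, |f.1 x - g.1 x|
  dist_self f := by simp
  dist_comm f g := by simp only [abs_sub_comm]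
  dist_triangle f g h := by
    have h0 : ∀ a b : InjectiveHull X, 0 ≤ ⨆ x, |a.1 x - b.1 x| :=
      fun a b => Real.iSup_nonneg fun x => abs_nonneg _
    refine Real.iSup_le (fun x => ?_) (add_nonneg (h0 f g) (h0 g h))
    exact (abs_sub_le _ (g.1 x) _).trans
      (add_le_add (le_ciSup (bddAbove_abs_sub f g) x) (le_ciSup (bddAbove_abs_sub g h) x))
  eq_of_dist_eq_zero := by
    intro f g hfg
    refine Subtype.ext (funext fun x => ?_)
    have h1 : |f.1 x - g.1 x| ≤ ⨆ x, |f.1 x - g.1 x| := le_ciSup (bddAbove_abs_sub f g) x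
    have h2 : |f.1 x - g.1 x| ≤ 0 := h1.trans (le_of_eq hfg)
    exact sub_eq_zero.1 (abs_nonpos_iff.1 h2)

end InjectiveHull

/-! ### Topological dimension -/

/-- `T` has (Lebesgue) covering dimension at most `n`: every open cover of `T` has an open
refinement such that every point of `T` lies in at most `n + 1` of its members. -/
def CoveringDimLE (T : Type*) [TopologicalSpace T] (n : ℕ) : Prop :=
  ∀ U : Set (Set T), (∀ u ∈ U, IsOpen u) → ⋃₀ U = univ →
    ∃ V : Set (Set T), (∀ v ∈ V, IsOpen v) ∧ ⋃₀ V = univ ∧ (∀ v ∈ V, ∃ u ∈ U, v ⊆ u) ∧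
      ∀ p : T, {v | v ∈ V ∧ p ∈ v}.encard ≤ n + 1

open Classical in
/-- The topological (Lebesgue covering) dimension of `T`. It is `⊤` if no natural number bounds
it, and `⊥` for the empty space. -/
noncomputable def coveringDim (T : Type*) [TopologicalSpace T] : WithBot ℕ∞ :=
  if IsEmpty T then ⊥ else ((⨅ (n : ℕ) (_ : CoveringDimLE T n), (n : ℕ∞) : ℕ∞) : WithBot ℕ∞)

/-- The combinatorial dimension of `X`: the topological dimension of its injective hull. -/
noncomputable def combinatorialDim (X : Type*) [MetricSpace X] : WithBot ℕ∞ :=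
  coveringDim (InjectiveHull X)

end CombDim

open CombDim

/-! Suppose that there are finitely many Busemann points `ξ` of `σ`-rays from `x₀`. Then every pair
`x ≠ y` has one with `ξ x - ξ y = d x y`: prolong the geodesic from `x` to `y` to a `σ`-ray `c`. For
each large `t`, the `σ`-ray from `x₀` through `c t` has a Busemann point with
`ξ x₀ - ξ (c t) = d x₀ (c t)`, and by finiteness one `ξ` serves for arbitrarily large `t`. As the
bicombing is conical, `ξ` lies below its chords from `c 0`, so its decay with asymptotic slope `-1`
along `c` already takes place between `x` and `y`.

Hence `x ↦ (ξ x - ξ x₀)` embeds `X`, and by McShane extension also its injective hull, isometrically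
in `ℝ^N` with the sup norm. Such a space has covering dimension at most `N`: pick `N + 1` disjoint
dense subsets `D j` of `ℝ`. The boxes whose faces have coordinates in `D j` form a basis, which
yields a disjoint open refinement of any cover off the points with a coordinate in `D j`, and no
point has a coordinate in every one of the `N + 1` sets. -/

namespace CombDim

section CoveringDimension

open TopologicalSpace

variable {T : Type*} [TopologicalSpace T]

/-- Every point has arbitrarily small open neighborhoods with frontier in `Z`. The smaller `Z` is,
the fewer points are missed when an open cover is refined by disjoint open sets. -/
def HasBasisWithFrontierIn (Z : Set T) : Prop :=
  IsTopologicalBasis {b : Set T | IsOpen b ∧ frontier b ⊆ Z}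

theorem HasBasisWithFrontierIn.of_isTopologicalBasis {B : Set (Set T)} {Z : Set T}
    (hB : IsTopologicalBasis B) (hZ : ∀ b ∈ B, frontier b ⊆ Z) : HasBasisWithFrontierIn Z :=
  hB.of_isOpen_of_subset (fun _ hb => hb.1) fun b hb => ⟨hB.isOpen hb, hZ b hb⟩

theorem HasBasisWithFrontierIn.preimage {S : Type*} [TopologicalSpace S] {φ : T → S} {Z : Set S}
    (hZ : HasBasisWithFrontierIn Z) (hφ : IsInducing φ) : HasBasisWithFrontierIn (φ ⁻¹' Z) := by
  refine .of_isTopologicalBasis (hZ.isInducing hφ) ?_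
  rintro _ ⟨b, hb, rfl⟩
  exact (hφ.continuous.frontier_preimage_subset b).trans (preimage_mono hb.2)

theorem frontier_finset_pi_subset {ι : Type*} {S : ι → Type*} [∀ i, TopologicalSpace (S i)]
    (F : Finset ι) (b : ∀ i, Set (S i)) :
    frontier ((F : Set ι).pi b) ⊆ {x | ∃ i ∈ F, x i ∈ frontier (b i)} := by
  rintro x ⟨hcl, hint⟩
  rw [closure_pi_set] at hcl
  rw [interior_pi_set F.finite_toSet, Set.mem_pi] at hint
  push Not at hint
  obtain ⟨i, hi, hxi⟩ := hint
  exact ⟨i, hi, hcl i hi, hxi⟩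

theorem HasBasisWithFrontierIn.pi {ι : Type*} {S : ι → Type*} [∀ i, TopologicalSpace (S i)]
    {Z : ∀ i, Set (S i)} (hZ : ∀ i, HasBasisWithFrontierIn (Z i)) :
    HasBasisWithFrontierIn {x : ∀ i, S i | ∃ i, x i ∈ Z i} := by
  refine .of_isTopologicalBasis (isTopologicalBasis_pi hZ) ?_
  rintro _ ⟨b, F, hb, rfl⟩ x hx
  obtain ⟨i, hi, hxi⟩ := frontier_finset_pi_subset F b hx
  exact ⟨i, (hb i hi).2 hxi⟩

theorem HasBasisWithFrontierIn.of_dense {α : Type*} [LinearOrder α] [TopologicalSpace α]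
    [OrderTopology α] [DenselyOrdered α] [NoMinOrder α] [NoMaxOrder α] {D : Set α}
    (hD : Dense D) : HasBasisWithFrontierIn D := by
  refine isTopologicalBasis_of_isOpen_of_nhds (fun _ hb => hb.1) fun x O hx hO => ?_
  obtain ⟨l, u, ⟨hlx, hxu⟩, hlu⟩ := mem_nhds_iff_exists_Ioo_subset.1 (hO.mem_nhds hx)
  obtain ⟨a, haD, hla, hax⟩ := hD.exists_between hlx
  obtain ⟨b, hbD, hxb, hbu⟩ := hD.exists_between hxu
  refine ⟨Ioo a b, ⟨isOpen_Ioo, ?_⟩, ⟨hax, hxb⟩, (Ioo_subset_Ioo hla.le hbu.le).trans hlu⟩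
  rw [frontier_Ioo (hax.trans hxb)]
  exact pair_subset haD hbD

theorem exists_isOpen_pairwise_disjoint_subset {g : ℕ → Set T} (hg : ∀ k, IsOpen (g k)) :
    ∃ W : ℕ → Set T, (∀ k, IsOpen (W k)) ∧ Pairwise (Function.onFun Disjoint W) ∧
      (∀ k, W k ⊆ g k) ∧ ∀ p ∈ ⋃ k, g k, (∀ k, p ∉ frontier (g k)) → p ∈ ⋃ k, W k := by
  let W : ℕ → Set T := fun k => g k \ ⋃ j ∈ Iio k, closure (g j)
  have hW : ∀ k, W k ⊆ disjointed g k := fun k p hp => by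
    simp only [disjointed_eq_inter_compl, mem_inter_iff, mem_iInter, mem_compl_iff]
    exact ⟨hp.1, fun j hj hpj => hp.2 (mem_biUnion hj (subset_closure hpj))⟩
  refine ⟨W, fun k => (hg k).sdiff ?_, ?_, fun k => sdiff_subset, fun p hp hfr => ?_⟩
  · exact (finite_Iio k).isClosed_biUnion fun _ _ => isClosed_closure
  · exact (disjoint_disjointed g).mono fun i j h => h.mono (hW i) (hW j)
  · rw [← iUnion_disjointed] at hp
    obtain ⟨k, hk⟩ := mem_iUnion.1 hp
    simp only [disjointed_eq_inter_compl, mem_inter_iff, mem_iInter, mem_compl_iff] at hk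
    refine mem_iUnion.2 ⟨k, hk.1, fun hmem => ?_⟩
    obtain ⟨j, hj, hpj⟩ := mem_iUnion₂.1 hmem
    exact hfr j ⟨hpj, (hg j).interior_eq.symm ▸ hk.2 j hj⟩

theorem HasBasisWithFrontierIn.exists_pairwiseDisjoint_refinement [LindelofSpace T] {Z : Set T}
    (hZ : HasBasisWithFrontierIn Z) {U : Set (Set T)} (hU : ∀ u ∈ U, IsOpen u)
    (hcov : ⋃₀ U = univ) :
    ∃ V : Set (Set T), (∀ v ∈ V, IsOpen v) ∧ V.PairwiseDisjoint id ∧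
      (∀ v ∈ V, ∃ u ∈ U, v ⊆ u) ∧ Zᶜ ⊆ ⋃₀ V := by
  have hsmall : ∀ p, ∃ b, (IsOpen b ∧ frontier b ⊆ Z) ∧ p ∈ b ∧ ∃ u ∈ U, b ⊆ u := fun p => by
    obtain ⟨u, hu, hpu⟩ : p ∈ ⋃₀ U := hcov ▸ mem_univ p
    obtain ⟨b, hb, hpb, hbu⟩ := IsTopologicalBasis.exists_subset_of_mem_open hZ hpu (hU u hu)
    exact ⟨b, hb, hpb, u, hu, hbu⟩
  choose b hb hmem hbU using hsmall
  obtain ⟨t, ht, htb⟩ :=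
    LindelofSpace.elim_nhds_subcover b fun p => (hb p).1.mem_nhds (hmem p)
  rcases t.eq_empty_or_nonempty with rfl | hne
  · have : IsEmpty T := univ_eq_empty_iff.1 (by simpa using htb.symm)
    exact ⟨∅, by simp, pairwiseDisjoint_empty, by simp, fun p => isEmptyElim p⟩
  obtain ⟨q, rfl⟩ := ht.exists_eq_range hne
  rw [biUnion_range] at htb
  obtain ⟨W, hWopen, hWdisj, hWsub, hWcov⟩ :=
    exists_isOpen_pairwise_disjoint_subset fun k => (hb (q k)).1
  refine ⟨range W, forall_mem_range.2 hWopen, hWdisj.range_pairwise, ?_, fun p hp => ?_⟩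
  · refine forall_mem_range.2 fun k => ?_
    obtain ⟨u, hu, hbu⟩ := hbU (q k)
    exact ⟨u, hu, (hWsub k).trans hbu⟩
  · exact hWcov p (htb ▸ mem_univ p) fun k hk => hp ((hb (q k)).2 hk)

theorem coveringDimLE_of_hasBasisWithFrontierIn [LindelofSpace T] {n : ℕ}
    {Z : Fin (n + 1) → Set T} (hZ : ∀ j, HasBasisWithFrontierIn (Z j)) (hinter : ⋂ j, Z j = ∅) :
    CoveringDimLE T n := by
  intro U hU hcov
  choose V hVopen hVdisj hVU hVcov using
    fun j => (hZ j).exists_pairwiseDisjoint_refinement hU hcov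
  refine ⟨⋃ j, V j, ?_, eq_univ_of_forall fun p => ?_, ?_, fun p => ?_⟩
  · simpa only [mem_iUnion, forall_exists_index] using fun v j => hVopen j v
  · obtain ⟨j, hj⟩ : ∃ j, p ∉ Z j := by
      simpa only [mem_iInter, not_forall] using eq_empty_iff_forall_notMem.1 hinter p
    exact sUnion_mono (subset_iUnion V j) (hVcov j hj)
  · simpa only [mem_iUnion, forall_exists_index] using fun v j => hVU j v
  · have hone : ∀ j, {v | v ∈ V j ∧ p ∈ v}.encard ≤ 1 := fun j =>
      encard_le_one_iff_subsingleton.2 fun v hv w hw =>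
        (hVdisj j).elim_set hv.1 hw.1 p hv.2 hw.2
    calc {v | v ∈ ⋃ j, V j ∧ p ∈ v}.encard = (⋃ j, {v | v ∈ V j ∧ p ∈ v}).encard := by
          congr 1; ext v; simp
      _ ≤ ∑ j, {v | v ∈ V j ∧ p ∈ v}.encard := encard_iUnion_le_of_fintype _
      _ ≤ ∑ _j : Fin (n + 1), 1 := Finset.sum_le_sum fun j _ => hone j
      _ = n + 1 := by simp

theorem exists_pairwise_disjoint_dense_real :
    ∃ D : ℕ → Set ℝ, (∀ j, Dense (D j)) ∧ Pairwise (Function.onFun Disjoint D) := by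
  refine ⟨fun j => range fun q : ℚ => (q : ℝ) + j * √2, fun j => ?_, fun j k hjk => ?_⟩
  · exact (Homeomorph.addRight (j * √2)).surjective.denseRange.comp Rat.denseRange_cast
      (Homeomorph.addRight _).continuous
  · refine disjoint_left.2 ?_
    rintro _ ⟨a, rfl⟩ ⟨b, hab⟩
    have hne : (j : ℤ) - k ≠ 0 := sub_ne_zero.2 (by exact_mod_cast hjk)
    refine (irrational_sqrt_two.intCast_mul hne).ne_rat (b - a) ?_
    push_cast
    linarith

theorem coveringDimLE_of_isInducing {ι : Type*} [Fintype ι] {φ : T → ι → ℝ} (hφ : IsInducing φ) :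
    CoveringDimLE T (Fintype.card ι) := by
  obtain ⟨D, hDdense, hDdisj⟩ := exists_pairwise_disjoint_dense_real
  have := hφ.secondCountableTopology
  refine coveringDimLE_of_hasBasisWithFrontierIn
    (Z := fun j => φ ⁻¹' {x | ∃ i, x i ∈ D j})
    (fun j => (HasBasisWithFrontierIn.pi fun _ => .of_dense (hDdense j)).preimage hφ)
    (eq_empty_of_forall_notMem fun p hp => ?_)
  choose i hi using mem_iInter.1 hp
  obtain ⟨j, k, hjk, hijk⟩ := Fintype.exists_ne_map_eq_of_card_lt i (by simp)
  exact disjoint_left.1 (hDdisj (Fin.val_ne_of_ne hjk)) (hi j) (hijk ▸ hi k)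

theorem coveringDim_le {n : ℕ} (h : CoveringDimLE T n) : coveringDim T ≤ n := by
  unfold coveringDim
  split_ifs
  · exact bot_le
  · exact WithBot.coe_le_coe.2 (iInf₂_le n h)

end CoveringDimension

namespace InjectiveHull

variable {X : Type*} [MetricSpace X]

theorem apply_nonneg (f : InjectiveHull X) (x : X) : 0 ≤ f.1 x := by
  have h := f.2.1 x x
  rw [dist_self] at h
  linarith

theorem abs_apply_sub_apply_le_dist (f g : InjectiveHull X) (x : X) :
    |f.1 x - g.1 x| ≤ dist f g :=
  le_ciSup (bddAbove_abs_sub f g) x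

end InjectiveHull

section Hull

variable {X ι : Type*} [MetricSpace X] [Fintype ι]

/-- The McShane extension of a `1`-Lipschitz function from `X` to its injective hull, where `X`
sits in the hull as the functions `dist x`; note that `f x` is the distance from `f` to
`dist x`. -/
noncomputable def hullExtension (u : X → ℝ) (f : InjectiveHull X) : ℝ :=
  ⨅ x, (u x + f.1 x)

section Lipschitz

variable {u : X → ℝ} (hu : LipschitzWith 1 u) (f : InjectiveHull X)
include hu

theorem sub_apply_le_add_apply (x y : X) : u y - f.1 y ≤ u x + f.1 x := by
  have h := hu.le_add_mul y x
  rw [NNReal.coe_one, one_mul] at h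
  linarith [f.2.1 y x]

theorem hullExtension_le (x : X) : hullExtension u f ≤ u x + f.1 x :=
  ciInf_le ⟨u x - f.1 x, forall_mem_range.2 fun y => sub_apply_le_add_apply hu f y x⟩ x

theorem abs_hullExtension_sub_le (x : X) : |hullExtension u f - u x| ≤ f.1 x := by
  have : Nonempty X := ⟨x⟩
  have hle := hullExtension_le hu f x
  have hge : u x - f.1 x ≤ hullExtension u f := le_ciInf fun y => sub_apply_le_add_apply hu f y x
  exact abs_sub_le_iff.2 ⟨by linarith, by linarith⟩

theorem lipschitzWith_hullExtension : LipschitzWith 1 (hullExtension u) := by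
  refine LipschitzWith.of_le_add fun f g => ?_
  rcases isEmpty_or_nonempty X with hX | hX
  · simp only [hullExtension, Real.iInf_of_isEmpty, zero_add, dist_nonneg]
  rw [← sub_le_iff_le_add]
  refine le_ciInf fun x => ?_
  linarith [hullExtension_le hu f x, le_of_abs_le (f.abs_apply_sub_apply_le_dist g x)]

end Lipschitz

variable {e : X → ι → ℝ}

theorem lipschitzWith_coord (he : Isometry e) (i : ι) : LipschitzWith 1 (e · i) :=
  LipschitzWith.mk_one fun x y => (dist_le_pi_dist _ _ i).trans_eq (he.dist_eq x y)

theorem dist_hullExtension_apply (he : Isometry e) (f : InjectiveHull X) (x : X) :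
    dist (fun i => hullExtension (e · i) f) (e x) = f.1 x := by
  have hle : ∀ x, dist (fun i => hullExtension (e · i) f) (e x) ≤ f.1 x := fun x =>
    (dist_pi_le_iff (f.apply_nonneg x)).2 fun i =>
      abs_hullExtension_sub_le (lipschitzWith_coord he i) f x
  have hdom : DominatesDist fun x => dist (fun i => hullExtension (e · i) f) (e x) := fun x y =>
    (he.dist_eq x y).symm.trans_le (dist_triangle_left _ _ _)
  exact le_antisymm (hle x) (f.2.2 hdom hle x)

theorem isometry_hullExtension (he : Isometry e) :
    Isometry fun (f : InjectiveHull X) i => hullExtension (e · i) f := by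
  refine Isometry.of_dist_eq fun f g => le_antisymm ?_ (Real.iSup_le (fun x => ?_) dist_nonneg)
  · refine (dist_pi_le_iff dist_nonneg).2 fun i => ?_
    simpa using (lipschitzWith_hullExtension (lipschitzWith_coord he i)).dist_le_mul f g
  · rw [← dist_hullExtension_apply he f, ← dist_hullExtension_apply he g]
    exact abs_dist_sub_le _ _ _

theorem combinatorialDim_le_card (he : Isometry e) : combinatorialDim X ≤ Fintype.card ι :=
  coveringDim_le (coveringDimLE_of_isInducing (isometry_hullExtension he).isEmbedding.isInducing)

end Hull

section Horoboundary

theorem FunModConst.diff_sub_diff {X : Type*} (ξ : FunModConst X) (x y z : X) :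
    ξ.diff x z - ξ.diff y z = ξ.diff x y := by
  induction ξ using QuotientAddGroup.induction_on with
  | H f => simp only [diff_mk, sub_sub_sub_cancel_right]

variable {X : Type*} [MetricSpace X]

/-- The Busemann function of a ray `c`, normalized to vanish at `c 0`. The limit exists if `c` is
a geodesic ray, and is a junk value in general. -/
noncomputable def busemannFun (c : ℝ → X) (x : X) : ℝ :=
  limUnder atTop fun t => dist x (c t) - t

namespace IsGeodesicRay

variable {c : ℝ → X} (hc : IsGeodesicRay c)
include hc

theorem dist_apply {s t : ℝ} (hs : 0 ≤ s) (hst : s ≤ t) : dist (c s) (c t) = t - s := by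
  rw [hc s t hs (hs.trans hst), abs_sub_comm, abs_of_nonneg (sub_nonneg.2 hst)]

theorem dist_zero_apply {t : ℝ} (ht : 0 ≤ t) : dist (c 0) (c t) = t := by
  rw [hc.dist_apply le_rfl ht, sub_zero]

theorem antitoneOn_dist_sub (x : X) : AntitoneOn (fun t => dist x (c t) - t) (Ici 0) := by
  intro s hs t _ hst
  have h := dist_triangle x (c s) (c t)
  rw [hc.dist_apply hs hst] at h
  linarith

theorem tendsto_busemannFun (x : X) :
    Tendsto (fun t => dist x (c t) - t) atTop (𝓝 (busemannFun c x)) := by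
  refine tendsto_nhds_limUnder ⟨_, tendsto_comp_val_Ici_atTop.1 <|
    tendsto_atTop_ciInf (antitoneOn_iff_antitone.1 (hc.antitoneOn_dist_sub x))
      ⟨-dist x (c 0), forall_mem_range.2 fun t => ?_⟩⟩
  have h := dist_triangle_left (c 0) (c t) x
  rw [hc.dist_zero_apply t.2] at h
  linarith

theorem isLimitOfRay_busemannFun :
    IsLimitOfRay (QuotientAddGroup.mk (busemannFun c) : FunModConst X) c := fun x y =>
  ((hc.tendsto_busemannFun x).sub (hc.tendsto_busemannFun y)).congr fun t => by ring

theorem tendsto_horoEmbedding :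
    Tendsto (fun t => horoEmbedding X (c t)) atTop (𝓝 (QuotientAddGroup.mk (busemannFun c))) := by
  have hpi : Tendsto (fun t x => dist x (c t) - t) atTop (𝓝 (busemannFun c)) :=
    tendsto_pi_nhds.2 hc.tendsto_busemannFun
  refine ((continuous_quot_mk.tendsto _).comp hpi).congr fun t => ?_
  refine QuotientAddGroup.eq.2 ⟨t, funext fun x => ?_⟩
  simp [dist_comm x (c t)]

theorem diff_zero_apply {ξ : FunModConst X} (hξ : IsLimitOfRay ξ c) {s : ℝ} (hs : 0 ≤ s) :
    ξ.diff (c 0) (c s) = s := by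
  refine tendsto_nhds_unique (hξ (c 0) (c s)) (tendsto_const_nhds.congr' ?_)
  filter_upwards [eventually_ge_atTop s] with t hst
  rw [hc.dist_zero_apply (hs.trans hst), hc.dist_apply hs hst, sub_sub_cancel]

theorem notMem_range_horoEmbedding {ξ : FunModConst X} (hξ : IsLimitOfRay ξ c) :
    ξ ∉ range (horoEmbedding X) := by
  rintro ⟨z, rfl⟩
  have h : dist z (c 0) - dist z (c (dist z (c 0) + 1)) = dist z (c 0) + 1 :=
    hc.diff_zero_apply hξ (by positivity)
  linarith [dist_nonneg (x := z) (y := c (dist z (c 0) + 1))]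

theorem isBusemannPoint_busemannFun :
    IsBusemannPoint (QuotientAddGroup.mk (busemannFun c) : FunModConst X) :=
  ⟨⟨mem_closure_of_tendsto hc.tendsto_horoEmbedding (.of_forall fun _ => mem_range_self _),
    hc.notMem_range_horoEmbedding hc.isLimitOfRay_busemannFun⟩,
    c, hc, hc.isLimitOfRay_busemannFun⟩

end IsGeodesicRay

theorem IsLimitOfRay.abs_diff_le_dist {c : ℝ → X} {ξ : FunModConst X} (hξ : IsLimitOfRay ξ c)
    (x y : X) : |ξ.diff x y| ≤ dist x y :=
  le_of_tendsto (hξ x y).abs (.of_forall fun _ => abs_dist_sub_le _ _ _)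

end Horoboundary

section Bicombing

variable {X : Type*} [MetricSpace X] {σ : X → X → ℝ → X} {x₀ : X}

theorem IsGeodesicBicombing.apply_self (hσ : IsGeodesicBicombing σ) (x : X) {t : ℝ}
    (ht : t ∈ Icc (0 : ℝ) 1) : σ x x t = x := by
  have h := hσ.dist_eq x x t ht 0 ⟨le_rfl, zero_le_one⟩
  rwa [dist_self, mul_zero, hσ.map_zero, dist_eq_zero] at h

theorem IsLimitOfRay.mul_diff_le_diff_combing (hσ : IsGeodesicBicombing σ) (hcon : IsConical σ)
    {c : ℝ → X} {ξ : FunModConst X} (hξ : IsLimitOfRay ξ c) (x y : X) {s : ℝ}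
    (hs : s ∈ Icc (0 : ℝ) 1) : s * ξ.diff x y ≤ ξ.diff x (σ x y s) := by
  refine le_of_tendsto_of_tendsto' ((hξ x y).const_mul s) (hξ _ _) fun t => ?_
  have h := hcon x (c t) y (c t) s hs
  rw [hσ.apply_self _ hs] at h
  linarith

theorem IsCombingRay.diff_zero_apply_of_frequently_le (hσ : IsGeodesicBicombing σ)
    (hcon : IsConical σ) {c c' : ℝ → X} (hc : IsCombingRay σ c) {ξ : FunModConst X}
    (hξ : IsLimitOfRay ξ c') {C : ℝ}
    (hfreq : ∃ᶠ t in atTop, t - C ≤ ξ.diff (c 0) (c t)) {r : ℝ} (hr : 0 ≤ r) :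
    ξ.diff (c 0) (c r) = r := by
  refine le_antisymm ?_ ?_
  · exact (le_of_abs_le (hξ.abs_diff_le_dist _ _)).trans_eq (hc.isGeodesicRay.dist_zero_apply hr)
  have hbound : ∃ᶠ t in atTop, r - r * C / t ≤ ξ.diff (c 0) (c r) := by
    refine (hfreq.and_eventually ((eventually_ge_atTop r).and (eventually_gt_atTop 0))).mono ?_
    rintro t ⟨hC, hrt, ht⟩
    have hs : r / t ∈ Icc (0 : ℝ) 1 := ⟨div_nonneg hr ht.le, (div_le_one ht).2 hrt⟩
    have hconvex := hξ.mul_diff_le_diff_combing hσ hcon (c 0) (c t) hs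
    rw [hc.combing_eq t ht.le _ hs, div_mul_cancel₀ _ ht.ne'] at hconvex
    calc r - r * C / t = r / t * (t - C) := by field_simp
      _ ≤ r / t * ξ.diff (c 0) (c t) := mul_le_mul_of_nonneg_left hC hs.1
      _ ≤ ξ.diff (c 0) (c r) := hconvex
  have htend : Tendsto (fun t : ℝ => r - r * C / t) atTop (𝓝 r) := by
    simpa using (tendsto_const_nhds (x := r)).sub
      ((tendsto_const_nhds (x := r * C)).div_atTop tendsto_id)
  exact le_of_tendsto_of_frequently htend hbound

theorem exists_diff_base_eq_dist (hcomp : IsGeodesicallyComplete σ) {z : X} (hz : x₀ ≠ z) :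
    ∃ ξ ∈ combingBusemannPoints σ x₀, ξ.diff x₀ z = dist x₀ z := by
  obtain ⟨c, hc, rfl, hcz⟩ := hcomp x₀ z hz
  have hray := hc.isGeodesicRay
  have h := hray.diff_zero_apply hray.isLimitOfRay_busemannFun (s := dist (c 0) z) dist_nonneg
  rw [hcz] at h
  exact ⟨_, ⟨hray.isBusemannPoint_busemannFun, c, hc, rfl, hray.isLimitOfRay_busemannFun⟩, h⟩

theorem IsGeodesicRay.exists_frequently_diff_eq_dist (hcomp : IsGeodesicallyComplete σ)
    (hfin : (combingBusemannPoints σ x₀).Finite) {c : ℝ → X} (hc : IsGeodesicRay c) :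
    ∃ ξ ∈ combingBusemannPoints σ x₀, ∃ᶠ t in atTop, ξ.diff x₀ (c t) = dist x₀ (c t) := by
  refine hfin.frequently_exists.1 (Eventually.frequently ?_)
  filter_upwards [eventually_gt_atTop (dist (c 0) x₀)] with t ht
  refine exists_diff_base_eq_dist hcomp fun h => ht.ne ?_
  rw [h, hc.dist_zero_apply (dist_nonneg.trans ht.le)]

theorem exists_diff_eq_dist (hσ : IsGeodesicBicombing σ) (hcon : IsConical σ)
    (hcomp : IsGeodesicallyComplete σ) (hfin : (combingBusemannPoints σ x₀).Finite) {x y : X}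
    (hxy : x ≠ y) : ∃ ξ ∈ combingBusemannPoints σ x₀, ξ.diff x y = dist x y := by
  obtain ⟨c, hc, rfl, hcy⟩ := hcomp x y hxy
  obtain ⟨ξ, hξ, hfreq⟩ := hc.isGeodesicRay.exists_frequently_diff_eq_dist hcomp hfin
  obtain ⟨-, c', -, -, hlim⟩ := id hξ
  have hslope : ∃ᶠ t in atTop, t - 2 * dist (c 0) x₀ ≤ ξ.diff (c 0) (c t) := by
    refine (hfreq.and_eventually (eventually_ge_atTop 0)).mono fun t ⟨hdiff, ht⟩ => ?_
    have hdist := dist_triangle (c 0) x₀ (c t)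
    rw [hc.isGeodesicRay.dist_zero_apply ht] at hdist
    linarith [hdiff, neg_le_of_abs_le (hlim.abs_diff_le_dist (c 0) x₀),
      ξ.diff_sub_diff (c 0) x₀ (c t)]
  have h := hc.diff_zero_apply_of_frequently_le hσ hcon hlim hslope (r := dist (c 0) y) dist_nonneg
  rw [hcy] at h
  exact ⟨ξ, hξ, h⟩

theorem isometry_combingBusemannPoints (hσ : IsGeodesicBicombing σ) (hcon : IsConical σ)
    (hcomp : IsGeodesicallyComplete σ) [Fintype (combingBusemannPoints σ x₀)] :
    Isometry fun (x : X) (ξ : combingBusemannPoints σ x₀) => ξ.1.diff x x₀ := by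
  have hdist : ∀ (ξ : FunModConst X) (x y : X),
      dist (ξ.diff x x₀) (ξ.diff y x₀) = |ξ.diff x y| := fun ξ x y => by
    rw [Real.dist_eq, ξ.diff_sub_diff]
  refine Isometry.of_dist_eq fun x y => le_antisymm ?_ ?_
  · refine (dist_pi_le_iff dist_nonneg).2 fun ⟨ξ, _, c, _, _, hlim⟩ => ?_
    exact (hdist ξ x y).trans_le (hlim.abs_diff_le_dist x y)
  · rcases eq_or_ne x y with rfl | hxy
    · simp only [dist_self, le_refl]
    obtain ⟨ξ, hξ, h⟩ := exists_diff_eq_dist (x₀ := x₀) hσ hcon hcomp (toFinite _) hxy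
    calc dist x y ≤ |ξ.diff x y| := h ▸ le_abs_self _
      _ = dist (ξ.diff x x₀) (ξ.diff y x₀) := (hdist ξ x y).symm
      _ ≤ _ := dist_le_pi_dist (fun ξ : combingBusemannPoints σ x₀ => ξ.1.diff x x₀)
        (fun ξ => ξ.1.diff y x₀) ⟨ξ, hξ⟩

end Bicombing

end CombDim

theorem theorem6p7_general {X : Type*} [MetricSpace X]
    (σ : X → X → ℝ → X) (hσ : IsGeodesicBicombing σ) (hcon : IsConical σ)
    (hcomp : IsGeodesicallyComplete σ) (x₀ : X) :
    combinatorialDim X ≤ (combingBusemannPoints σ x₀).encard := by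
  rcases (combingBusemannPoints σ x₀).finite_or_infinite with hfin | hinf
  · have := hfin.fintype
    rw [← coe_fintypeCard]
    exact combinatorialDim_le_card (isometry_combingBusemannPoints hσ hcon hcomp)
  · rw [hinf.encard_eq]
    exact le_top

theorem theorem6p7 {X : Type*} [MetricSpace X] [ProperSpace X]
    (σ : X → X → ℝ → X) (hσ : IsGeodesicBicombing σ) (hcon : IsConical σ)
    (hcomp : IsGeodesicallyComplete σ) (x₀ : X) (N : ℕ)
    (hN : (combingBusemannPoints σ x₀).encard ≤ N) :
    combinatorialDim X ≤ N :=
  (theorem6p7_general σ hσ hcon hcomp x₀).trans (WithBot.coe_le_coe.2 hN)
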